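/- Let $\mathbb{C}P^n$ be the complex projective space with homogeneous coordinates $[z_0:z_1:\cdots:z_n]$, and let $P_i=\{z_i=0\}$, $0\le i\le n$, be the coordinate hyperplanes. Equip $\mathbb{C}P^n$ with the Fubini–Study metric, whose fundamental form in the affine coordinates $[1:z_1:\cdots:z_n]$ is $$\omega_{FS}=\sqrt{-1}\sum_{i,j} g_{i\bar j}\,dz_i\wedge d\bar z_j=\frac{\sqrt{-1}}{2\pi}\,\partial\bar\partial\log\Bigl(1+\sum_{k=1}^n|z_k|^2\Bigr),$$ and for a holomorphic curve $f:\mathbb{C}\to\mathbb{C}P^n$ put $|df|(z)=\sqrt2\,\bigl|df(\partial/\partial z)\bigr|$, where $\bigl|\sum_i v_i\,\partial/\partial z_i\bigr|^2=\sum_{i,j} g_{i\bar j}v_i\bar v_j$, and $\|df\|=\sup_{z\in\mathbb{C}}|df|(z)$. Let $f:\mathbb{C}\to\mathbb{C}P^n\setminus(P_0\cup\cdots\cup P_n)$ be a holomorphic map with $\|df\|<\infty$. Then there are complex numbers $a_i$ and $b_i$ $(1\le i\le n)$ such that, for all $z\in\mathbb{C}$, $$f(z)=[\,1:\exp(a_1z+b_1):\exp(a_2z+b_2):\cdots:\exp(a_nz+b_n)\,].$$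 -/

import Mathlib

open scoped LinearAlgebra.Projectivization Manifold ContDiff

noncomputable section

/-- Complex projective space of complex dimension `n`: the lines through the origin
in `ℂ^(n+1)`. -/
abbrev ComplexProjectiveSpace (n : ℕ) : Type := ℙ ℂ (Fin (n + 1) → ℂ)

namespace ComplexProjectiveSpace

variable {n : ℕ}

/-! ### The complex manifold structure -/

/-- The quotient topology from `ℂ^(n+1) ∖ {0}`. -/
instance : TopologicalSpace (ComplexProjectiveSpace n) :=
  TopologicalSpace.coinduced (Projectivization.mk' ℂ) inferInstance

theorem isQuotientMap_mk' : Topology.IsQuotientMap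
    (Projectivization.mk' ℂ : {v : Fin (n + 1) → ℂ // v ≠ 0} → ComplexProjectiveSpace n) :=
  ⟨⟨rfl⟩, Quotient.mk''_surjective⟩

theorem continuous_coord (i : Fin (n + 1)) :
    Continuous fun v : {v : Fin (n + 1) → ℂ // v ≠ 0} => v.1 i :=
  (continuous_apply i).comp continuous_subtype_val

/-- The coordinate hyperplane `z_i = 0`. -/
def hyperplane (i : Fin (n + 1)) : Set (ComplexProjectiveSpace n) :=
  {p | p.rep i = 0}

theorem mk_mem_hyperplane (i : Fin (n + 1)) (v : Fin (n + 1) → ℂ) (hv : v ≠ 0) :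
    Projectivization.mk ℂ v hv ∈ hyperplane i ↔ v i = 0 := by
  obtain ⟨a, ha⟩ := Projectivization.exists_smul_eq_mk_rep ℂ v hv
  simp [hyperplane, ← ha, Units.smul_def]

/-- The affine coordinates `(z_j / z_i)`, `j ≠ i`, on the complement of `z_i = 0`. -/
def affineCoord (i : Fin (n + 1)) (p : ComplexProjectiveSpace n) : Fin n → ℂ :=
  fun j => p.rep (i.succAbove j) / p.rep i

theorem affineCoord_mk (i : Fin (n + 1)) (v : Fin (n + 1) → ℂ) (hv : v ≠ 0) :
    affineCoord i (Projectivization.mk ℂ v hv) = fun j => v (i.succAbove j) / v i := by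
  obtain ⟨a, ha⟩ := Projectivization.exists_smul_eq_mk_rep ℂ v hv
  funext j
  simp only [affineCoord, ← ha, Units.smul_def, Pi.smul_apply, smul_eq_mul]
  exact mul_div_mul_left _ _ a.ne_zero

theorem insertNth_one_ne_zero (i : Fin (n + 1)) (w : Fin n → ℂ) :
    (i.insertNth 1 w : Fin (n + 1) → ℂ) ≠ 0 := by
  intro h
  have := congrFun h i
  simp at this

/-- The point whose homogeneous coordinates are `1` in position `i` and `w` in the others. -/
def affinePoint (i : Fin (n + 1)) (w : Fin n → ℂ) : ComplexProjectiveSpace n :=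
  Projectivization.mk ℂ (i.insertNth 1 w) (insertNth_one_ne_zero i w)

theorem isOpen_compl_hyperplane (i : Fin (n + 1)) : IsOpen (hyperplane (n := n) i)ᶜ := by
  rw [← isQuotientMap_mk'.isOpen_preimage]
  have : (Projectivization.mk' ℂ ⁻¹' (hyperplane i)ᶜ : Set {v : Fin (n + 1) → ℂ // v ≠ 0}) =
      {v | v.1 i ≠ 0} := by
    ext v
    simp [mk_mem_hyperplane]
  rw [this]
  exact isOpen_ne_fun (continuous_coord i) continuous_const

/-- The standard affine chart on the complement of `z_i = 0`. -/
def affineChart (i : Fin (n + 1)) :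
    OpenPartialHomeomorph (ComplexProjectiveSpace n) (Fin n → ℂ) where
  toFun := affineCoord i
  invFun := affinePoint i
  source := (hyperplane i)ᶜ
  target := Set.univ
  map_source' _ _ := Set.mem_univ _
  map_target' w _ := by simp [affinePoint, mk_mem_hyperplane]
  left_inv' p hp := by
    induction p using Projectivization.ind with
    | h v hv =>
      have hvi : v i ≠ 0 := by simpa [mk_mem_hyperplane] using hp
      rw [affinePoint, affineCoord_mk, Projectivization.mk_eq_mk_iff']
      refine ⟨(v i)⁻¹, ?_⟩
      rw [Fin.eq_insertNth_iff]
      refine ⟨by simp [hvi], ?_⟩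
      funext j
      simp [Fin.removeNth, div_eq_inv_mul]
  right_inv' w _ := by
    rw [affinePoint, affineCoord_mk]
    simp
  open_source := isOpen_compl_hyperplane i
  open_target := isOpen_univ
  continuousOn_toFun := by
    rw [isQuotientMap_mk'.continuousOn_isOpen_iff (isOpen_compl_hyperplane i)]
    have h : (affineCoord i ∘ Projectivization.mk' ℂ) =
        fun (v : {v : Fin (n + 1) → ℂ // v ≠ 0}) j => v.1 (i.succAbove j) / v.1 i :=
      funext fun v => affineCoord_mk i v.1 v.2
    rw [h]
    refine continuousOn_pi.2 fun j => ContinuousOn.div (continuous_coord _).continuousOn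
      (continuous_coord _).continuousOn fun v hv => ?_
    simpa [mk_mem_hyperplane] using hv
  continuousOn_invFun := by
    have h : Continuous fun w : Fin n → ℂ =>
        (⟨i.insertNth 1 w, insertNth_one_ne_zero i w⟩ : {v : Fin (n + 1) → ℂ // v ≠ 0}) :=
      Continuous.subtype_mk (Continuous.finInsertNth (A := fun _ => ℂ) i
        (continuous_const (y := (1 : ℂ))) continuous_id) _
    exact (isQuotientMap_mk'.continuous.comp h).continuousOn

theorem exists_rep_ne_zero (p : ComplexProjectiveSpace n) : ∃ i, p.rep i ≠ 0 :=
  Function.ne_iff.1 p.rep_nonzero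

open Classical in
/-- The least index of a nonzero homogeneous coordinate. -/
def chartIndex (p : ComplexProjectiveSpace n) : Fin (n + 1) :=
  Fin.find (fun i => p.rep i ≠ 0) (exists_rep_ne_zero p)

open Classical in
theorem rep_chartIndex_ne_zero (p : ComplexProjectiveSpace n) : p.rep (chartIndex p) ≠ 0 :=
  Fin.find_spec (exists_rep_ne_zero p)

/-- The atlas of the `n + 1` standard affine charts. -/
instance : ChartedSpace (Fin n → ℂ) (ComplexProjectiveSpace n) where
  atlas := Set.range affineChart
  chartAt p := affineChart (chartIndex p)
  mem_chart_source := rep_chartIndex_ne_zero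
  chart_mem_atlas _ := Set.mem_range_self _

/-- The transition maps between the affine charts are holomorphic. -/
instance : IsManifold 𝓘(ℂ, Fin n → ℂ) ω (ComplexProjectiveSpace n) := by
  apply isManifold_of_contDiffOn
  rintro _ _ ⟨i, rfl⟩ ⟨j, rfl⟩
  have h : ∀ k, ContDiff ℂ ω fun w : Fin n → ℂ => (i.insertNth 1 w : Fin (n + 1) → ℂ) k := by
    intro k
    rcases Fin.eq_self_or_eq_succAbove i k with rfl | ⟨l, rfl⟩
    · simpa using contDiff_const
    · simpa using contDiff_apply ℂ ℂ l
  have h2 : ContDiffOn ℂ ω (affineCoord j ∘ affinePoint i : (Fin n → ℂ) → (Fin n → ℂ))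
      {w | (i.insertNth 1 w : Fin (n + 1) → ℂ) j ≠ 0} := by
    have : (affineCoord j ∘ affinePoint i : (Fin n → ℂ) → (Fin n → ℂ)) = fun w k =>
        (i.insertNth 1 w : Fin (n + 1) → ℂ) (j.succAbove k) /
          (i.insertNth 1 w : Fin (n + 1) → ℂ) j := by
      funext w
      exact affineCoord_mk j _ _
    rw [this]
    exact contDiffOn_pi.2 fun k => (h _).contDiffOn.div (h _).contDiffOn fun w hw => hw
  refine h2.mono ?_ |>.congr ?_
  · intro w hw
    have h3 : affinePoint i w ∈ (hyperplane j)ᶜ := hw.1.2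
    simpa [affinePoint, mk_mem_hyperplane] using h3
  · intro w _
    rfl

/-! ### The Fubini–Study metric -/

/-- The Wirtinger derivative `∂F/∂z_i`. -/
def wirtinger (i : Fin n) (F : (Fin n → ℂ) → ℂ) (z : Fin n → ℂ) : ℂ :=
  (fderiv ℝ F z (Pi.single i 1) - Complex.I * fderiv ℝ F z (Pi.single i Complex.I)) / 2

/-- The conjugate Wirtinger derivative `∂F/∂z̄_i`. -/
def wirtingerBar (i : Fin n) (F : (Fin n → ℂ) → ℂ) (z : Fin n → ℂ) : ℂ :=
  (fderiv ℝ F z (Pi.single i 1) + Complex.I * fderiv ℝ F z (Pi.single i Complex.I)) / 2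

/-- The coefficients `g_{ij̄} = (1 / 2π) ∂²/∂z_i∂z̄_j log (1 + ∑ |z_k|²)` of the Fubini–Study
form `ω = √-1 ∑ g_{ij̄} dz_i ∧ dz̄_j = (√-1 / 2π) ∂∂̄ log (1 + ∑ |z_k|²)` in affine coordinates.
They have the same expression in each of the `n + 1` affine charts. -/
def fubiniStudyCoeff (i j : Fin n) (z : Fin n → ℂ) : ℂ :=
  1 / (2 * Real.pi) *
    wirtinger i (wirtingerBar j fun w => (Real.log (1 + ∑ k, ‖w k‖ ^ 2) : ℂ)) z

/-- The Fubini–Study length `√(∑ g_{ij̄} v_i v̄_j)` of the `(1,0)`-vector `∑ v_i ∂/∂z_i` at `p`.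
A tangent vector at `p` is given by its components in the chart `chartAt _ p`. -/
def fubiniStudyNorm (p : ComplexProjectiveSpace n)
    (v : TangentSpace 𝓘(ℂ, Fin n → ℂ) p) : ℝ :=
  let u : Fin n → ℂ := v
  √(∑ i, ∑ j, fubiniStudyCoeff i j (chartAt (Fin n → ℂ) p p) * u i * star (u j)).re

/-- The pointwise norm `|df|(z) = √2 |df(∂/∂z)|` of the differential of a holomorphic curve. -/
def differentialNorm (f : ℂ → ComplexProjectiveSpace n) (z : ℂ) : ℝ :=
  √2 * fubiniStudyNorm (f z) (mfderiv 𝓘(ℂ) 𝓘(ℂ, Fin n → ℂ) f z (1 : ℂ))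

/-- `‖df‖ = sup_z |df|(z)`, with values in `[0, ∞]`. -/
def differentialSupNorm (f : ℂ → ComplexProjectiveSpace n) : ENNReal :=
  ⨆ z, ENNReal.ofReal (differentialNorm f z)

end ComplexProjectiveSpace

end

/-! ### The Fubini–Study metric in affine coordinates -/

noncomputable section
namespace ComplexProjectiveSpace

variable {n : ℕ}

/-! Since `f` misses the hyperplanes, it is `[1 : exp g₁ : ⋯ : exp gₙ]` with entire `gₖ`. Finiteness
of `‖df‖` bounds the energy density, which is a quarter of the Laplacian of `φ = log (1 + ∑ |exp
gₖ|²)`, by a constant `C`. This bound is used twice.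

Growth. For `C' > C` the function `φ - C' |z|²` is strictly superharmonic, so the averages of `φ`
over circles of radius `R` grow at most like `R²` (`circleAverage_log_one_add_sum_le`). As `|Re gₖ|
≤ φ - Re gₖ` and `Re gₖ` is harmonic, the averages of `|Re gₖ|` grow no faster, and Cauchy's
estimates make `gₖ` a polynomial of degree at most two (`Differentiable.exists_eq_quadratic`).

No quadratic term. Put `g₀ = 0`. The density is also the variance of the logarithmic derivatives
`gₖ'` under weights proportional to `|exp gₖ|²`. An index of maximal modulus carries weight at least
`1 / (n + 1)`, so `|gᵢ' - gⱼ'|` is bounded wherever `i` and `j` are both maximal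
(`norm_sub_le_of_forall_norm_le`). If two leading coefficients differed, connectedness of a large
circle would give a point on it where two maximal indices have different leading coefficients; there
the derivatives differ by an amount linear in the radius. Hence all leading coefficients equal that
of `g₀`, which is zero (`leadingCoeff_eq_of_norm_deriv_sub_le`). -/

theorem hasFDerivAt_one_add_sum_norm_sq (z : Fin n → ℂ) :
    HasFDerivAt (fun w : Fin n → ℂ => 1 + ∑ k, ‖w k‖ ^ 2)
      (∑ k, (2 : ℝ) • (innerSL ℝ (z k)).comp
        (ContinuousLinearMap.proj (R := ℝ) (φ := fun _ : Fin n => ℂ) k)) z := by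
  refine HasFDerivAt.const_add 1 (HasFDerivAt.fun_sum fun k _ => ?_)
  have h := (hasStrictFDerivAt_norm_sq (z k)).hasFDerivAt.comp z
    (ContinuousLinearMap.proj (R := ℝ) (φ := fun _ : Fin n => ℂ) k).hasFDerivAt
  refine h.congr_fderiv ?_
  ext v
  simp
  ring

theorem sum_two_inner_single (z : Fin n → ℂ) (i : Fin n) (c : ℂ) :
    (∑ k, (2 : ℝ) • (innerSL ℝ (z k)).comp
        (ContinuousLinearMap.proj (R := ℝ) (φ := fun _ : Fin n => ℂ) k)) (Pi.single i c) =
      2 * (c * star (z i)).re := by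
  rw [sum_apply, Finset.sum_eq_single i]
  · simp [Complex.inner]
  · intro k _ hk
    simp [Pi.single_eq_of_ne hk]
  · simp

theorem one_add_sum_norm_sq_pos {ι : Type*} [Fintype ι] (z : ι → ℂ) :
    0 < 1 + ∑ k, ‖z k‖ ^ 2 := by positivity

theorem wirtinger_eq_of_hasFDerivAt {F : (Fin n → ℂ) → ℂ} {z : Fin n → ℂ}
    {L : (Fin n → ℂ) →L[ℝ] ℂ} (h : HasFDerivAt F L z) (i : Fin n) :
    wirtinger i F z = (L (Pi.single i 1) - Complex.I * L (Pi.single i Complex.I)) / 2 := by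
  rw [wirtinger, h.fderiv]

theorem wirtingerBar_eq_of_hasFDerivAt {F : (Fin n → ℂ) → ℂ} {z : Fin n → ℂ}
    {L : (Fin n → ℂ) →L[ℝ] ℂ} (h : HasFDerivAt F L z) (i : Fin n) :
    wirtingerBar i F z = (L (Pi.single i 1) + Complex.I * L (Pi.single i Complex.I)) / 2 := by
  rw [wirtingerBar, h.fderiv]

theorem wirtingerBar_log_one_add_sum (j : Fin n) (z : Fin n → ℂ) :
    wirtingerBar j (fun w => (Real.log (1 + ∑ k, ‖w k‖ ^ 2) : ℂ)) z =
      z j / ((1 + ∑ k, ‖z k‖ ^ 2 : ℝ) : ℂ) := by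
  have hpos := one_add_sum_norm_sq_pos z
  have h := Complex.ofRealCLM.hasFDerivAt.comp z
    ((hasFDerivAt_one_add_sum_norm_sq z).log hpos.ne')
  rw [wirtingerBar_eq_of_hasFDerivAt
    (F := fun w => (Real.log (1 + ∑ k, ‖w k‖ ^ 2) : ℂ)) h]
  have hne : ((1 + ∑ k, ‖z k‖ ^ 2 : ℝ) : ℂ) ≠ 0 := by exact_mod_cast hpos.ne'
  generalize (1 + ∑ k, ‖z k‖ ^ 2 : ℝ) = T at *
  simp only [ContinuousLinearMap.comp_apply, smul_apply,
    sum_two_inner_single, Complex.ofRealCLM_apply, smul_eq_mul, Complex.ofReal_mul,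
    Complex.ofReal_inv]
  -- `Im z_j = Re (i z̄_j)`, so the two real directional derivatives recombine to `z_j`.
  have hz : z j = ((1 * star (z j)).re : ℂ) + Complex.I * ((Complex.I * star (z j)).re : ℂ) := by
    apply Complex.ext <;> simp
  conv_rhs => rw [hz]
  push_cast
  field_simp

/-- This is `∂/∂z_i` of `z_j / T`, where `T = 1 + ∑ |z_k|²` and `∂T/∂z_i = z̄_i`. -/
theorem fubiniStudyCoeff_eq (i j : Fin n) (z : Fin n → ℂ) :
    fubiniStudyCoeff i j z = 1 / (2 * Real.pi) *
      ((if i = j then 1 else 0) / ((1 + ∑ k, ‖z k‖ ^ 2 : ℝ) : ℂ) -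
        star (z i) * z j / ((1 + ∑ k, ‖z k‖ ^ 2 : ℝ) : ℂ) ^ 2) := by
  have hpos := one_add_sum_norm_sq_pos z
  have hne : ((1 + ∑ k, ‖z k‖ ^ 2 : ℝ) : ℂ) ≠ 0 := by exact_mod_cast hpos.ne'
  rw [fubiniStudyCoeff, funext fun w => wirtingerBar_log_one_add_sum j w]
  congr 1
  have hinv := (hasDerivAt_inv hne).hasFDerivAt.restrictScalars ℝ |>.comp z
    (Complex.ofRealCLM.hasFDerivAt.comp z (hasFDerivAt_one_add_sum_norm_sq z))
  have h := (ContinuousLinearMap.proj (R := ℝ) (φ := fun _ : Fin n => ℂ) j).hasFDerivAt (x := z)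
    |>.mul hinv
  simp only [div_eq_mul_inv]
  rw [wirtinger_eq_of_hasFDerivAt (F := fun w : Fin n → ℂ =>
    w j * ((1 + ∑ k, ‖w k‖ ^ 2 : ℝ) : ℂ)⁻¹) h]
  simp only [add_apply, smul_apply,
    ContinuousLinearMap.comp_apply, sum_two_inner_single, Function.comp_apply,
    Complex.ofRealCLM_apply, ContinuousLinearMap.proj_apply]
  generalize (1 + ∑ k, ‖z k‖ ^ 2 : ℝ) = T at *
  have hd : ∀ c : ℂ, (Pi.single i c : Fin n → ℂ) j = (if i = j then 1 else 0) * c := by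
    intro c
    by_cases hij : i = j
    · subst hij; simp
    · simp [hij]
  rw [hd, hd]
  generalize (if i = j then (1 : ℂ) else 0) = d
  have hconj : star (z i) = ((1 * star (z i)).re : ℂ) - Complex.I * ((Complex.I * star (z i)).re : ℂ) := by
    apply Complex.ext <;> simp
  conv_rhs => rw [hconj]
  simp
  field_simp
  ring_nf
  simp
  ring

theorem sum_fubiniStudyCoeff (z u : Fin n → ℂ) :
    (∑ i, ∑ j, fubiniStudyCoeff i j z * u i * star (u j)).re = 1 / (2 * Real.pi) *
      ((∑ k, ‖u k‖ ^ 2) / (1 + ∑ k, ‖z k‖ ^ 2) -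
        ‖∑ k, star (z k) * u k‖ ^ 2 / (1 + ∑ k, ‖z k‖ ^ 2) ^ 2) := by
  have key : ∑ i, ∑ j, fubiniStudyCoeff i j z * u i * star (u j) = ((1 / (2 * Real.pi) *
      ((∑ k, ‖u k‖ ^ 2) / (1 + ∑ k, ‖z k‖ ^ 2) -
        ‖∑ k, star (z k) * u k‖ ^ 2 / (1 + ∑ k, ‖z k‖ ^ 2) ^ 2) : ℝ) : ℂ) := by
    have h1 : ∀ i j, fubiniStudyCoeff i j z * u i * star (u j) =
        1 / (2 * Real.pi) * ((1 / ((1 + ∑ k, ‖z k‖ ^ 2 : ℝ) : ℂ)) *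
          (if i = j then u i * star (u j) else 0) -
          1 / ((1 + ∑ k, ‖z k‖ ^ 2 : ℝ) : ℂ) ^ 2 * ((star (z i) * u i) * star (star (z j) * u j))) := by
      intro i j
      rw [fubiniStudyCoeff_eq]
      split_ifs <;> simp <;> ring
    simp_rw [h1, ← Finset.mul_sum, Finset.sum_sub_distrib, ← Finset.mul_sum]
    rw [← Finset.sum_mul, ← star_sum]
    simp only [Finset.sum_ite_eq, Finset.mem_univ, if_true]
    have h2 : ∀ w : ℂ, w * star w = ((‖w‖ ^ 2 : ℝ) : ℂ) := by
      intro w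
      rw [Complex.star_def, Complex.mul_conj, Complex.normSq_eq_norm_sq]
    simp_rw [h2]
    push_cast
    ring
  rw [key, Complex.ofReal_re]

/-! ### Curves that avoid the coordinate hyperplanes -/

theorem rep_ne_zero_of_notMem {p : ComplexProjectiveSpace n}
    (hp : p ∉ ⋃ i, hyperplane i) (i : Fin (n + 1)) : p.rep i ≠ 0 := by
  intro h
  exact hp (Set.mem_iUnion.2 ⟨i, h⟩)

open Classical in
-- A single chart therefore serves along the whole curve, and `mfderiv` becomes an ordinary
-- derivative of the affine coordinates.
theorem chartIndex_eq_zero {p : ComplexProjectiveSpace n} (hp : p ∉ ⋃ i, hyperplane i) :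
    chartIndex p = 0 := by
  have := Fin.find_min (exists_rep_ne_zero p) (j := 0)
  by_contra h
  exact this (Fin.pos_of_ne_zero h) (rep_ne_zero_of_notMem hp 0)

theorem chartAt_eq_affineChart_zero {p : ComplexProjectiveSpace n}
    (hp : p ∉ ⋃ i, hyperplane i) : chartAt (Fin n → ℂ) p = affineChart 0 :=
  congrArg affineChart (chartIndex_eq_zero hp)

theorem writtenInExtChartAt_eq_affineCoord {f : ℂ → ComplexProjectiveSpace n}
    (hP : ∀ z, f z ∉ ⋃ i, hyperplane i) (z : ℂ) :
    writtenInExtChartAt 𝓘(ℂ) 𝓘(ℂ, Fin n → ℂ) z f = fun w => affineCoord 0 (f w) := by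
  funext w
  simp [writtenInExtChartAt, extChartAt, chartAt_eq_affineChart_zero (hP z)]
  rfl

theorem differentiable_affineCoord {f : ℂ → ComplexProjectiveSpace n}
    (hf : MDifferentiable 𝓘(ℂ) 𝓘(ℂ, Fin n → ℂ) f) (hP : ∀ z, f z ∉ ⋃ i, hyperplane i) :
    Differentiable ℂ fun w => affineCoord 0 (f w) := by
  intro z
  have h := (mdifferentiableAt_iff _ _).1 (hf z) |>.2
  rw [writtenInExtChartAt_eq_affineCoord hP] at h
  have h' : DifferentiableWithinAt ℂ (fun w => affineCoord 0 (f w)) (Set.range 𝓘(ℂ)) z := h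
  rw [modelWithCornersSelf_coe, Set.range_id] at h'
  exact differentiableWithinAt_univ.1 h'

theorem differentialNorm_eq {f : ℂ → ComplexProjectiveSpace n}
    (hf : MDifferentiable 𝓘(ℂ) 𝓘(ℂ, Fin n → ℂ) f) (hP : ∀ z, f z ∉ ⋃ i, hyperplane i) (z : ℂ) :
    differentialNorm f z = √2 * √(1 / (2 * Real.pi) *
      ((∑ k, ‖deriv (fun w => affineCoord 0 (f w) k) z‖ ^ 2) /
          (1 + ∑ k, ‖affineCoord 0 (f z) k‖ ^ 2) -
        ‖∑ k, star (affineCoord 0 (f z) k) * deriv (fun w => affineCoord 0 (f w) k) z‖ ^ 2 /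
          (1 + ∑ k, ‖affineCoord 0 (f z) k‖ ^ 2) ^ 2)) := by
  have hu : (mfderiv 𝓘(ℂ) 𝓘(ℂ, Fin n → ℂ) f z (1 : ℂ) : Fin n → ℂ) =
      fun k => deriv (fun w => affineCoord 0 (f w) k) z := by
    rw [(hf z).mfderiv, writtenInExtChartAt_eq_affineCoord hP]
    funext k
    have := hasDerivAt_pi.1 ((differentiable_affineCoord hf hP) z).hasDerivAt k
    rw [this.deriv]
    simp only [modelWithCornersSelf_coe, Set.range_id, fderivWithin_univ]
    rfl
  rw [differentialNorm, fubiniStudyNorm, chartAt_eq_affineChart_zero (hP z)]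
  congr 2
  rw [← sum_fubiniStudyCoeff]
  exact congrArg (fun u : Fin n → ℂ => (∑ i, ∑ j,
    fubiniStudyCoeff i j (affineCoord 0 (f z)) * u i * star (u j)).re) hu

theorem exists_forall_differentialNorm_le {f : ℂ → ComplexProjectiveSpace n}
    (hdf : differentialSupNorm f < ⊤) : ∃ M : ℝ, 0 ≤ M ∧ ∀ z, differentialNorm f z ≤ M := by
  refine ⟨(differentialSupNorm f).toReal, ENNReal.toReal_nonneg, fun z => ?_⟩
  exact (ENNReal.ofReal_le_iff_le_toReal hdf.ne).1
    (le_iSup (fun z => ENNReal.ofReal (differentialNorm f z)) z)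

theorem exists_energyDensity_le {f : ℂ → ComplexProjectiveSpace n}
    (hf : MDifferentiable 𝓘(ℂ) 𝓘(ℂ, Fin n → ℂ) f) (hP : ∀ z, f z ∉ ⋃ i, hyperplane i)
    (hdf : differentialSupNorm f < ⊤) : ∃ C : ℝ, ∀ z,
      (∑ k, ‖deriv (fun w => affineCoord 0 (f w) k) z‖ ^ 2) /
          (1 + ∑ k, ‖affineCoord 0 (f z) k‖ ^ 2) -
        ‖∑ k, star (affineCoord 0 (f z) k) * deriv (fun w => affineCoord 0 (f w) k) z‖ ^ 2 /
          (1 + ∑ k, ‖affineCoord 0 (f z) k‖ ^ 2) ^ 2 ≤ C := by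
  obtain ⟨M, hM, h⟩ := exists_forall_differentialNorm_le hdf
  -- The squared norm is `2 · 1/(2π) = 1/π` times the density.
  refine ⟨Real.pi * M ^ 2, fun z => ?_⟩
  have hz := h z
  rw [differentialNorm_eq hf hP, ← Real.sqrt_mul (by norm_num), Real.sqrt_le_left hM] at hz
  rw [← div_le_iff₀' Real.pi_pos]
  refine le_trans (le_of_eq ?_) hz
  field_simp

end ComplexProjectiveSpace
end

/-! ### Mean value inequality for strictly superharmonic functions -/

open Topology in
-- If `g'' < 0`, the second derivative test makes `x` a local maximum as well, so `g` is locally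
-- constant and `g'' = 0`.
theorem IsLocalMin.deriv_deriv_nonneg {g : ℝ → ℝ} {x : ℝ} (hg : ContDiff ℝ 2 g)
    (hx : IsLocalMin g x) : 0 ≤ deriv (deriv g) x := by
  by_contra! h
  have hmax : IsLocalMax g x :=
    isLocalMax_of_deriv_deriv_neg h hx.deriv_eq_zero hg.continuous.continuousAt
  have hconst : g =ᶠ[𝓝 x] fun _ => g x := by
    filter_upwards [hx, hmax] with y h1 h2 using le_antisymm h2 h1
  have h2 : deriv (deriv g) x = 0 := by
    rw [hconst.deriv.deriv_eq]
    simp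
  exact h.ne h2

/-- The second derivative of `h` at `z` in the direction `e`. -/
noncomputable def secondDirectionalDeriv (h : ℂ → ℝ) (z e : ℂ) : ℝ :=
  deriv (deriv fun t : ℝ => h (z + t * e)) 0

theorem ContDiff.comp_line {h : ℂ → ℝ} (hh : ContDiff ℝ 2 h) (z e : ℂ) :
    ContDiff ℝ 2 fun t : ℝ => h (z + t * e) :=
  hh.comp (contDiff_const.add (Complex.ofRealCLM.contDiff.mul contDiff_const))

open Topology in
theorem IsLocalMin.secondDirectionalDeriv_nonneg {h : ℂ → ℝ} {z : ℂ} (hh : ContDiff ℝ 2 h)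
    (hz : IsLocalMin h z) (e : ℂ) : 0 ≤ secondDirectionalDeriv h z e := by
  refine IsLocalMin.deriv_deriv_nonneg (hh.comp_line z e) ?_
  have hc : ContinuousAt (fun t : ℝ => z + t * e) 0 := by fun_prop
  refine hc.eventually (p := fun w => h (z + (0 : ℝ) * e) ≤ h w) ?_
  simpa using (show ∀ᶠ w in 𝓝 z, h z ≤ h w from hz)

/-- A negative Laplacian excludes interior local minima, so the minimum over the closed disc is
attained on the circle. -/
theorem exists_mem_sphere_le_center {h : ℂ → ℝ} (hh : ContDiff ℝ 2 h) {e : ℂ}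
    (hneg : ∀ z, secondDirectionalDeriv h z e +
      secondDirectionalDeriv h z (Complex.I * e) < 0) {R : ℝ} (hR : 0 ≤ R) :
    ∃ z ∈ Metric.sphere (0 : ℂ) R, h z ≤ h 0 := by
  obtain ⟨z, hz, hmin⟩ := (isCompact_closedBall (0 : ℂ) R).exists_isMinOn
    ⟨0, by simpa using hR⟩ hh.continuous.continuousOn
  refine ⟨z, ?_, hmin (by simpa using hR)⟩
  by_contra hzs
  have hzb : z ∈ Metric.ball (0 : ℂ) R :=
    Metric.mem_ball.2 (lt_of_le_of_ne (Metric.mem_closedBall.1 hz) fun h => hzs h)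
  have hloc : IsLocalMin h z := hmin.isLocalMin
    (Filter.mem_of_superset (Metric.isOpen_ball.mem_nhds hzb) Metric.ball_subset_closedBall)
  linarith [hneg z, hloc.secondDirectionalDeriv_nonneg hh e,
    hloc.secondDirectionalDeriv_nonneg hh (Complex.I * e)]

theorem secondDirectionalDeriv_fun_sum {ι : Type*} (s : Finset ι) {h : ι → ℂ → ℝ}
    (hh : ∀ i ∈ s, ContDiff ℝ 2 (h i)) (z e : ℂ) :
    secondDirectionalDeriv (fun w => ∑ i ∈ s, h i w) z e =
      ∑ i ∈ s, secondDirectionalDeriv (h i) z e := by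
  have h1 : (deriv fun t : ℝ => ∑ i ∈ s, h i (z + t * e)) =
      fun t => ∑ i ∈ s, deriv (fun t : ℝ => h i (z + t * e)) t := by
    funext t
    exact deriv_fun_sum fun i hi => ((hh i hi).comp_line z e).differentiable (by norm_num) t
  rw [secondDirectionalDeriv, h1, deriv_fun_sum]
  · rfl
  · intro i hi
    exact ((hh i hi).comp_line z e).differentiable_deriv_two 0

theorem secondDirectionalDeriv_comp_mul (h : ℂ → ℝ) (c z e : ℂ) :
    secondDirectionalDeriv (fun w => h (c * w)) z e = secondDirectionalDeriv h (c * z) (c * e) := by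
  simp only [secondDirectionalDeriv]
  congr 2
  funext t
  ring_nf

open Real in
/-- A finite average of rotates of a continuous function is close to its circle average. -/
theorem exists_circleAverage_le_sum_rotations {h : ℂ → ℝ} (hh : Continuous h) {R : ℝ}
    (hR : 0 ≤ R) {ε : ℝ} (hε : 0 < ε) : ∃ N : ℕ, 0 < N ∧ ∀ z ∈ Metric.sphere (0 : ℂ) R,
      N * circleAverage h 0 R ≤
        ∑ k ∈ Finset.range N, (h (Complex.exp ((2 * π * k / N : ℝ) * Complex.I) * z) + ε) := by
  have hcont : Continuous fun θ : ℝ => h (circleMap 0 R θ) := hh.comp (continuous_circleMap 0 R)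
  -- The angles that occur run over one turn starting at some `η ≤ 2π`, so they stay below `4π`;
  -- `6π` leaves room.
  have huc := (isCompact_Icc (a := (0 : ℝ)) (b := 6 * π)).uniformContinuousOn_of_continuous
    hcont.continuousOn
  obtain ⟨δ, hδ, hd⟩ := Metric.uniformContinuousOn_iff_le.1 huc ε hε
  obtain ⟨M, hM⟩ := exists_nat_gt (2 * π / δ)
  have hMpos : (0 : ℝ) < M := lt_trans (by positivity) hM
  refine ⟨M, by exact_mod_cast hMpos, fun z hz => ?_⟩
  obtain ⟨η, hη, hzη⟩ : ∃ η ∈ Set.Icc 0 (2 * π), circleMap 0 R η = z := by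
    have hz' : z ∈ Metric.sphere (0 : ℂ) |R| := by rwa [abs_of_nonneg hR]
    rw [← image_circleMap_Ioc] at hz'
    obtain ⟨η, hη, h⟩ := hz'
    exact ⟨η, ⟨hη.1.le, hη.2⟩, h⟩
  have hstep : 2 * π / M ≤ δ := by
    rw [div_lt_iff₀ hδ] at hM
    rw [div_le_iff₀ hMpos]
    linarith
  have hpi := pi_pos
  have hint := fun a b => hcont.intervalIntegrable (μ := MeasureTheory.volume) a b
  -- The partition starts at the angle of `z`, so its nodes are the rotates of `z`; its mesh does
  -- not depend on `z`.
  have hsum : circleAverage h 0 R = (2 * π)⁻¹ * ∑ k ∈ Finset.range M,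
      ∫ θ in (η + 2 * π * (k : ℕ) / M)..(η + 2 * π * ((k + 1 : ℕ) : ℝ) / M),
        h (circleMap 0 R θ) := by
    rw [intervalIntegral.sum_integral_adjacent_intervals
      (a := fun k : ℕ => η + 2 * π * k / M) fun k _ => hint _ _, circleAverage_eq_integral_add η,
      intervalIntegral.integral_comp_add_right (fun θ => h (circleMap 0 R θ))]
    simp only [smul_eq_mul]
    congr 2
    · simp
    · field_simp
      ring
  have hle : ∀ k ∈ Finset.range M,
      ∫ θ in (η + 2 * π * (k : ℕ) / M)..(η + 2 * π * ((k + 1 : ℕ) : ℝ) / M),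
        h (circleMap 0 R θ) ≤
      (2 * π / M) * (h (Complex.exp ((2 * π * k / M : ℝ) * Complex.I) * z) + ε) := by
    intro k hk
    have hkM : ((k : ℝ) + 1) ≤ M := by exact_mod_cast Finset.mem_range.1 hk
    have hlen : (η + 2 * π * ((k + 1 : ℕ) : ℝ) / M) - (η + 2 * π * (k : ℕ) / M) = 2 * π / M := by
      push_cast
      ring
    have hk0 : 0 ≤ 2 * π * k / M := by positivity
    have hk1 : η + 2 * π * ((k + 1 : ℕ) : ℝ) / M ≤ 4 * π := by
      have : 2 * π * ((k + 1 : ℕ) : ℝ) / M ≤ 2 * π := by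
        rw [div_le_iff₀ hMpos]
        push_cast
        gcongr
      linarith [hη.2]
    have hab : (η + 2 * π * (k : ℕ) / M) ≤ (η + 2 * π * ((k + 1 : ℕ) : ℝ) / M) := by
      have : 0 ≤ 2 * π / M := by positivity
      linarith
    have hpt : Complex.exp ((2 * π * k / M : ℝ) * Complex.I) * z =
        circleMap 0 R (η + 2 * π * k / M) := by
      rw [← hzη]
      simp only [circleMap, zero_add]
      rw [Complex.ofReal_add, add_mul, Complex.exp_add]
      ring
    rw [hpt, ← hlen, ← smul_eq_mul (_ - _), ← intervalIntegral.integral_const]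
    refine intervalIntegral.integral_mono_on hab (hint _ _) intervalIntegrable_const fun θ hθ => ?_
    have := hd θ ⟨by linarith [hη.1, hθ.1], by linarith [hθ.2]⟩ (η + 2 * π * k / M)
      ⟨by linarith [hη.1], by linarith⟩ (by
        rw [Real.dist_eq, abs_of_nonneg (by linarith [hθ.1])]
        linarith [hθ.2])
    rw [Real.dist_eq] at this
    linarith [(abs_le.1 this).2]
  calc M * circleAverage h 0 R
      ≤ M * ((2 * π)⁻¹ * ∑ k ∈ Finset.range M, (2 * π / M) *
          (h (Complex.exp ((2 * π * k / M : ℝ) * Complex.I) * z) + ε)) := by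
        rw [hsum]
        gcongr with k hk
        exact hle k hk
    _ = _ := by
        rw [← Finset.mul_sum, ← mul_assoc, ← mul_assoc,
          show (M : ℝ) * (2 * π)⁻¹ * (2 * π / M) = 1 by field_simp, one_mul]

open Real in
/-- The mean value inequality for a strictly superharmonic function. -/
theorem circleAverage_le_of_secondDirectionalDeriv_neg {h : ℂ → ℝ} (hh : ContDiff ℝ 2 h)
    (hneg : ∀ z e : ℂ, ‖e‖ = 1 → secondDirectionalDeriv h z e +
      secondDirectionalDeriv h z (Complex.I * e) < 0) {R : ℝ} (hR : 0 ≤ R) :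
    circleAverage h 0 R ≤ h 0 := by
  refine le_of_forall_pos_le_add fun ε hε => ?_
  obtain ⟨N, hN, hav⟩ := exists_circleAverage_le_sum_rotations hh.continuous hR hε
  set c : ℕ → ℂ := fun k => Complex.exp ((2 * π * k / N : ℝ) * Complex.I) with hc
  have hcn : ∀ k, ‖c k‖ = 1 := fun k => Complex.norm_exp_ofReal_mul_I _
  have hsm : ∀ k ∈ Finset.range N, ContDiff ℝ 2 fun z => h (c k * z) := fun k _ =>
    hh.comp (contDiff_const.mul contDiff_id)
  -- The sum over rotates is again strictly superharmonic, with value `N * h 0` at the centre. A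
  -- point of the circle where it does not exceed this value serves as the start of the Riemann sum.
  -- Rotation by `c k` turns the direction `1` into `c k`, whence the hypothesis for all unit `e`.
  obtain ⟨z, hz, hle⟩ := exists_mem_sphere_le_center
    (h := fun z => ∑ k ∈ Finset.range N, h (c k * z)) (e := 1)
    (ContDiff.sum hsm) (fun z => by
      rw [secondDirectionalDeriv_fun_sum _ hsm, secondDirectionalDeriv_fun_sum _ hsm,
        ← Finset.sum_add_distrib]
      refine Finset.sum_neg (fun k _ => ?_) ⟨0, Finset.mem_range.2 hN⟩
      rw [secondDirectionalDeriv_comp_mul, secondDirectionalDeriv_comp_mul,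
        show c k * (Complex.I * 1) = Complex.I * c k by ring, mul_one]
      exact hneg _ _ (hcn k)) hR
  have h1 := hav z hz
  simp only [mul_zero, Finset.sum_const, Finset.card_range, nsmul_eq_mul] at hle
  rw [Finset.sum_add_distrib] at h1
  simp only [Finset.sum_const, Finset.card_range, nsmul_eq_mul] at h1
  have hN' : (0 : ℝ) < N := by exact_mod_cast hN
  refine le_of_mul_le_mul_left ?_ hN'
  linarith

/-! ### Circle averages and Cauchy estimates from the real part -/

open Real in
theorem norm_circleAverage_le {E : Type*} [NormedAddCommGroup E] [NormedSpace ℝ E]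
    (f : ℂ → E) (c : ℂ) (R : ℝ) :
    ‖circleAverage f c R‖ ≤ circleAverage (fun z => ‖f z‖) c R := by
  rw [circleAverage, circleAverage, norm_smul, smul_eq_mul, Real.norm_of_nonneg (by positivity)]
  gcongr
  exact intervalIntegral.norm_integral_le_integral_norm two_pi_pos.le

open Real in
theorem Differentiable.circleAverage_eq {f : ℂ → ℂ} (hf : Differentiable ℂ f) (c : ℂ) (R : ℝ) :
    circleAverage f c R = f c :=
  circleAverage_of_differentiable_on_off_countable Set.countable_empty hf.continuous.continuousOn
    fun z _ => hf z

open Real in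
theorem Differentiable.circleAverage_re_eq {f : ℂ → ℂ} (hf : Differentiable ℂ f) (c : ℂ) (R : ℝ) :
    circleAverage (fun z => (f z).re) c R = (f c).re := by
  rw [← hf.circleAverage_eq c R]
  exact Complex.reCLM.circleAverage_comp_comm hf.continuous.continuousOn.circleIntegrable'

open Real in
theorem Differentiable.circleAverage_inv_pow_mul {g : ℂ → ℂ} (hg : Differentiable ℂ g) (m : ℕ)
    {R : ℝ} (hR : 0 < R) :
    circleAverage (fun z => (z ^ m)⁻¹ * g z) 0 R = iteratedDeriv m g 0 / m.factorial := by
  rw [circleAverage_eq_circleIntegral hR.ne']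
  have h := hg.differentiableOn.circleIntegral_one_div_sub_center_pow_smul (c := 0) hR m
  have h2 : (∮ z in C(0, R), (z - 0)⁻¹ • ((z ^ m)⁻¹ * g z)) =
      ∮ z in C(0, R), (1 / (z - 0) ^ (m + 1)) • g z := by
    congr 1
    funext z
    simp only [sub_zero, smul_eq_mul, one_div, pow_succ, mul_inv]
    ring
  rw [h2, h, smul_smul, smul_eq_mul]
  have : (2 * π * Complex.I : ℂ) ≠ 0 := Complex.two_pi_I_ne_zero
  field_simp

open Real in
-- On the circle `z̄ = R² / z`, so the integrand is the conjugate of the entire function `R^(-2m)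
-- z^m g`, which vanishes at the centre.
theorem Differentiable.circleAverage_inv_pow_mul_star {g : ℂ → ℂ} (hg : Differentiable ℂ g) {m : ℕ}
    (hm : m ≠ 0) {R : ℝ} (hR : 0 < R) :
    circleAverage (fun z => (z ^ m)⁻¹ * star (g z)) 0 R = 0 := by
  have hd : Differentiable ℂ fun z => ((R : ℂ) ^ (2 * m))⁻¹ * (z ^ m * g z) := by fun_prop
  have h1 : Set.EqOn (fun z => (z ^ m)⁻¹ * star (g z))
      (Complex.conjCLE ∘ fun z => ((R : ℂ) ^ (2 * m))⁻¹ * (z ^ m * g z))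
      (Metric.sphere 0 |R|) := by
    intro z hz
    have hzR : ‖z‖ = R := by simpa [abs_of_pos hR] using hz
    have hz0 : z ≠ 0 := by
      rw [← norm_pos_iff, hzR]
      exact hR
    have hzz : (starRingEnd ℂ) z * z = (R : ℂ) ^ 2 := by
      rw [Complex.conj_mul', hzR]
    have hR0 : (R : ℂ) ≠ 0 := by exact_mod_cast hR.ne'
    have hzz' : (starRingEnd ℂ) z = (R : ℂ) ^ 2 / z := by
      field_simp
      exact hzz
    simp [hzz', pow_mul, div_pow]
    field_simp
  rw [circleAverage_congr_sphere h1]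
  have h2 := (Complex.conjCLE : ℂ →L[ℝ] ℂ).circleAverage_comp_comm
    (hd.continuous.continuousOn.circleIntegrable' (c := 0) (R := R))
  rw [hd.circleAverage_eq] at h2
  simpa [hm] using h2

open Real in
-- Adding the conjugate term, whose average is zero, to Cauchy's formula replaces `g` by `2 Re g`.
theorem Differentiable.norm_iteratedDeriv_le_circleAverage_re {g : ℂ → ℂ}
    (hg : Differentiable ℂ g) {m : ℕ} (hm : m ≠ 0) {R : ℝ} (hR : 0 < R) :
    ‖iteratedDeriv m g 0 / m.factorial‖ ≤
      2 * (R ^ m)⁻¹ * circleAverage (fun z => |(g z).re|) 0 R := by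
  have hc : ∀ f : ℂ → ℂ, Continuous f → CircleIntegrable (fun z => (z ^ m)⁻¹ * f z) 0 R := by
    intro f hf
    refine ContinuousOn.circleIntegrable hR.le (ContinuousOn.mul (ContinuousOn.inv₀ (by fun_prop) ?_)
      hf.continuousOn)
    intro z hz
    refine pow_ne_zero _ ?_
    rw [← norm_pos_iff, mem_sphere_zero_iff_norm.1 hz]
    exact hR
  have hsum := circleAverage_fun_add (hc g hg.continuous)
    (hc (fun z => star (g z)) hg.continuous.star)
  rw [hg.circleAverage_inv_pow_mul m hR, hg.circleAverage_inv_pow_mul_star hm hR, add_zero] at hsum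
  rw [← hsum]
  refine (norm_circleAverage_le _ _ _).trans (le_of_eq ?_)
  rw [← smul_eq_mul, ← circleAverage_fun_smul]
  refine circleAverage_congr_sphere fun z hz => ?_
  have hzR : ‖z‖ = R := by simpa [abs_of_pos hR] using hz
  simp only [smul_eq_mul]
  rw [← mul_add, Complex.star_def, Complex.add_conj, norm_mul, norm_inv, norm_pow, hzR,
    Complex.norm_real, Real.norm_eq_abs, abs_mul, abs_two]
  ring

open Real in
/-- An entire function whose real part has circle averages of quadratic growth is a polynomial of
degree at most two. -/
theorem Differentiable.exists_eq_quadratic {g : ℂ → ℂ} (hg : Differentiable ℂ g) {K : ℝ}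
    (hK : ∀ R : ℝ, 1 ≤ R → circleAverage (fun z => |(g z).re|) 0 R ≤ K * R ^ 2) :
    ∃ a b c : ℂ, ∀ z, g z = a * z ^ 2 + b * z + c := by
  have hz : ∀ m : ℕ, 3 ≤ m → iteratedDeriv m g 0 = 0 := by
    intro m hm
    -- The coefficient is at most `2 K R^(2-m)`; for `m ≥ 3` a factor `R` is to spare.
    have hle : ∀ R : ℝ, 1 ≤ R → ‖iteratedDeriv m g 0 / m.factorial‖ * R ≤ 2 * K := by
      intro R hR
      have hR0 : 0 < R := by linarith
      have h1 := hg.norm_iteratedDeriv_le_circleAverage_re (m := m) (by omega) hR0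
      have hK0 : 0 ≤ K := by
        have := (circleAverage_nonneg_of_nonneg (c := 0) (R := R) (f := fun z => |(g z).re|)
          fun z _ => abs_nonneg _).trans (hK R hR)
        exact nonneg_of_mul_nonneg_left this (by positivity)
      calc ‖iteratedDeriv m g 0 / m.factorial‖ * R
          ≤ 2 * (R ^ m)⁻¹ * (K * R ^ 2) * R := by
            gcongr
            refine h1.trans ?_
            gcongr
            exact hK R hR
        _ = 2 * K * (R ^ 3 / R ^ m) := by
            field_simp
        _ ≤ 2 * K * 1 := by
            gcongr
            exact div_le_one_of_le₀ (pow_le_pow_right₀ hR hm) (by positivity)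
        _ = 2 * K := mul_one _
    have h0 : ‖iteratedDeriv m g 0 / m.factorial‖ = 0 := by
      by_contra hne
      have hpos : 0 < ‖iteratedDeriv m g 0 / m.factorial‖ :=
        lt_of_le_of_ne (norm_nonneg _) (Ne.symm hne)
      -- At this radius the bound would give `‖coefficient‖ + 2 * K ≤ 2 * K`.
      have := hle (max 1 (2 * K / ‖iteratedDeriv m g 0 / m.factorial‖ + 1)) (le_max_left _ _)
      have h2 := (mul_le_mul_of_nonneg_left (le_max_right 1
        (2 * K / ‖iteratedDeriv m g 0 / m.factorial‖ + 1)) hpos.le).trans this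
      rw [mul_add, mul_div_cancel₀ _ hpos.ne'] at h2
      linarith
    rw [norm_eq_zero, div_eq_zero_iff] at h0
    exact h0.resolve_right (by exact_mod_cast m.factorial_ne_zero)
  refine ⟨iteratedDeriv 2 g 0 / 2, iteratedDeriv 1 g 0, iteratedDeriv 0 g 0, fun z => ?_⟩
  rw [← Complex.taylorSeries_eq_of_entire' 0 z hg, tsum_eq_sum (s := Finset.range 3)]
  · simp [Finset.sum_range_succ]
    ring
  · intro m hm
    rw [hz m (by simpa using hm)]
    simp

/-! ### The Laplacian of `log (1 + ∑ |F_k|²)` -/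

theorem hasDerivAt_comp_line {F : ℂ → ℂ} (hF : Differentiable ℂ F) (z e : ℂ)
    (t : ℝ) : HasDerivAt (fun t : ℝ => F (z + t * e)) (e * deriv F (z + t * e)) t := by
  have h1 : HasDerivAt (fun t : ℝ => z + t * e) (1 * e) t :=
    (Complex.ofRealCLM.hasDerivAt.mul_const e).const_add z
  have h2 := (hF (z + t * e)).hasDerivAt.scomp t h1
  exact h2.congr_deriv (by simp)

section

variable {ι : Type*} [Fintype ι] {F : ι → ℂ → ℂ}

theorem contDiff_log_one_add_sum_norm_sq (hF : ∀ k, Differentiable ℂ (F k)) :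
    ContDiff ℝ 2 fun z => Real.log (1 + ∑ k, ‖F k z‖ ^ 2) := by
  have h : ContDiff ℝ 2 fun z => 1 + ∑ k, ‖F k z‖ ^ 2 :=
    contDiff_const.add (ContDiff.sum fun k _ =>
      ((hF k).contDiff.restrict_scalars ℝ).norm_sq ℝ)
  exact h.log fun z => by positivity

/-- Quotient rule along the line. The term with `e ^ 2` changes sign under `e ↦ i e`, so it drops
out of the Laplacian. -/
theorem secondDirectionalDeriv_log_one_add_sum (hF : ∀ k, Differentiable ℂ (F k)) (C : ℝ)
    (z e : ℂ) :
    secondDirectionalDeriv (fun w => Real.log (1 + ∑ k, ‖F k w‖ ^ 2) - C * ‖w‖ ^ 2) z e =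
      (2 * (‖e‖ ^ 2 * ∑ k, ‖deriv (F k) z‖ ^ 2 +
          (e ^ 2 * ∑ k, star (F k z) * deriv (deriv (F k)) z).re) * (1 + ∑ k, ‖F k z‖ ^ 2) -
        4 * (e * ∑ k, star (F k z) * deriv (F k) z).re ^ 2) / (1 + ∑ k, ‖F k z‖ ^ 2) ^ 2 -
        2 * C * ‖e‖ ^ 2 := by
  have hline : ∀ (G : ℂ → ℂ), Differentiable ℂ G → ∀ t : ℝ,
      HasDerivAt (fun t : ℝ => ‖G (z + t * e)‖ ^ 2)
        (2 * (e * (star (G (z + t * e)) * deriv G (z + t * e))).re) t := by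
    intro G hG t
    have h := (hasDerivAt_comp_line hG z e t).norm_sq
    refine h.congr_deriv ?_
    rw [Complex.inner, Complex.star_def]
    congr 2
    ring
  have hS : ∀ t : ℝ, HasDerivAt (fun t : ℝ => 1 + ∑ k, ‖F k (z + t * e)‖ ^ 2)
      (2 * (e * ∑ k, star (F k (z + t * e)) * deriv (F k) (z + t * e)).re) t := by
    intro t
    refine ((HasDerivAt.fun_sum fun k _ => hline (F k) (hF k) t).const_add 1).congr_deriv ?_
    rw [← Finset.mul_sum, Finset.mul_sum Finset.univ _ e, Complex.re_sum]
  have hfirst : (deriv fun t : ℝ => Real.log (1 + ∑ k, ‖F k (z + t * e)‖ ^ 2) -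
      C * ‖z + t * e‖ ^ 2) = fun t : ℝ =>
      (2 * (e * ∑ k, star (F k (z + t * e)) * deriv (F k) (z + t * e)).re) /
        (1 + ∑ k, ‖F k (z + t * e)‖ ^ 2) - C * (2 * (e * star (z + t * e)).re) := by
    funext t
    refine HasDerivAt.deriv (HasDerivAt.sub ((hS t).log (by positivity)) (HasDerivAt.const_mul C ?_))
    simpa using hline (fun w => w) differentiable_id t
  have hQ : HasDerivAt (fun t : ℝ => ∑ k, star (F k (z + t * e)) * deriv (F k) (z + t * e))
      (∑ k, (star (e * deriv (F k) z) * deriv (F k) z +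
        star (F k z) * (e * deriv (deriv (F k)) z))) 0 := by
    refine HasDerivAt.fun_sum fun k _ => ?_
    have h := (hasDerivAt_comp_line (hF k) z e 0).star.mul
      (hasDerivAt_comp_line (hF k).deriv z e 0)
    exact h.congr_deriv (by simp)
  have hre : ∀ {u : ℝ → ℂ} {u' : ℂ} {t : ℝ}, HasDerivAt u u' t →
      HasDerivAt (fun t => (e * u t).re) (e * u').re t := fun h =>
    Complex.reCLM.hasFDerivAt.comp_hasDerivAt _ (h.const_mul e)
  have hlin : HasDerivAt (fun t : ℝ => star (z + t * e)) (star e) 0 := by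
    have h := (hasDerivAt_comp_line differentiable_id z e 0).star
    simpa using h
  have hsecond := (((hre hQ).const_mul 2).div (hS 0) (by positivity)).sub
    (((hre hlin).const_mul 2).const_mul C)
  rw [secondDirectionalDeriv, hfirst]
  refine hsecond.deriv.trans ?_
  have hee : ∀ w : ℂ, (w * star w).re = ‖w‖ ^ 2 := by
    intro w
    rw [Complex.star_def, Complex.mul_conj, Complex.ofReal_re, Complex.normSq_eq_norm_sq]
  have hsplit : (e * ∑ k, (star (e * deriv (F k) z) * deriv (F k) z +
        star (F k z) * (e * deriv (deriv (F k)) z))).re = ‖e‖ ^ 2 * ∑ k, ‖deriv (F k) z‖ ^ 2 +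
          (e ^ 2 * ∑ k, star (F k z) * deriv (deriv (F k)) z).re := by
    rw [Finset.sum_add_distrib, mul_add, Complex.add_re, Finset.mul_sum, Complex.re_sum,
      Finset.mul_sum, Finset.mul_sum, Finset.mul_sum]
    congr 1
    · refine Finset.sum_congr rfl fun k _ => ?_
      rw [← mul_pow, ← norm_mul, ← hee]
      congr 1
      ring
    · congr 1
      refine Finset.sum_congr rfl fun k _ => ?_
      ring
  simp only [Complex.ofReal_zero, zero_mul, add_zero]
  rw [hsplit, hee]
  ring

open Real in
theorem circleAverage_log_one_add_sum_le (hF : ∀ k, Differentiable ℂ (F k)) {C : ℝ}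
    (hC : ∀ z, (∑ k, ‖deriv (F k) z‖ ^ 2) / (1 + ∑ k, ‖F k z‖ ^ 2) -
      ‖∑ k, star (F k z) * deriv (F k) z‖ ^ 2 / (1 + ∑ k, ‖F k z‖ ^ 2) ^ 2 < C)
    {R : ℝ} (hR : 0 ≤ R) :
    circleAverage (fun z => Real.log (1 + ∑ k, ‖F k z‖ ^ 2)) 0 R ≤
      Real.log (1 + ∑ k, ‖F k 0‖ ^ 2) + C * R ^ 2 := by
  have hφ := contDiff_log_one_add_sum_norm_sq hF
  have hsq : ContDiff ℝ 2 fun z : ℂ => C * ‖z‖ ^ 2 := contDiff_const.mul (contDiff_id.norm_sq ℝ)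
  have h := circleAverage_le_of_secondDirectionalDeriv_neg (hφ.sub hsq) (fun z e he => by
    have hz := hC z
    have hT : 0 < 1 + ∑ k, ‖F k z‖ ^ 2 := by positivity
    refine (congrArg₂ (· + ·) (secondDirectionalDeriv_log_one_add_sum hF C z e)
      (secondDirectionalDeriv_log_one_add_sum hF C z (Complex.I * e))).trans_lt ?_
    -- For `|e| = 1` and a complex number `s`, the real parts of `e s` and `i e s` are, up to sign,
    -- the real and imaginary parts of `e s`.
    have hn : ‖∑ k, star (F k z) * deriv (F k) z‖ ^ 2 =
        (e * ∑ k, star (F k z) * deriv (F k) z).re ^ 2 +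
        (Complex.I * e * ∑ k, star (F k z) * deriv (F k) z).re ^ 2 := by
      rw [mul_assoc, Complex.I_mul_re, neg_sq, ← one_mul ‖_‖, ← he, ← norm_mul, Complex.sq_norm,
        Complex.normSq_apply]
      ring
    rw [hn] at hz
    rw [mul_pow Complex.I, Complex.I_sq, neg_one_mul, neg_mul, Complex.neg_re, norm_mul,
      Complex.norm_I, he]
    generalize (e * ∑ k, star (F k z) * deriv (F k) z).re = p at *
    generalize (Complex.I * e * ∑ k, star (F k z) * deriv (F k) z).re = q at *
    generalize (e ^ 2 * ∑ k, star (F k z) * deriv (deriv (F k)) z).re = r at *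
    generalize (1 + ∑ k, ‖F k z‖ ^ 2) = T at *
    generalize ∑ k, ‖deriv (F k) z‖ ^ 2 = A at *
    -- The sum over both directions is four times the density minus `C`.
    have h4 : (2 * (1 ^ 2 * A + r) * T - 4 * p ^ 2) / T ^ 2 - 2 * C * 1 ^ 2 +
        ((2 * ((1 * 1) ^ 2 * A + -r) * T - 4 * q ^ 2) / T ^ 2 - 2 * C * (1 * 1) ^ 2) =
        4 * (A / T - (p ^ 2 + q ^ 2) / T ^ 2 - C) := by
      field_simp
      ring
    rw [h4]
    linarith) hR
  rw [circleAverage_fun_sub hφ.continuous.continuousOn.circleIntegrable'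
    hsq.continuous.continuousOn.circleIntegrable',
    circleAverage_const_on_circle (f := fun z : ℂ => C * ‖z‖ ^ 2) (a := C * R ^ 2)] at h
  · simp only [norm_zero] at h
    linarith
  · intro z hz
    have : ‖z‖ = |R| := by simpa using hz
    simp [this]

end

/-- `|x| = 2 max(x, 0) - x`, and the logarithm dominates both `0` and `2 Re u_k`. -/
theorem abs_le_log_one_add_sum_sub {ι : Type*} [Fintype ι] (u : ι → ℂ) (k : ι) :
    |(u k).re| ≤ Real.log (1 + ∑ k, ‖Complex.exp (u k)‖ ^ 2) - (u k).re := by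
  have hpos : 0 ≤ ∑ k, ‖Complex.exp (u k)‖ ^ 2 := by positivity
  rcases le_total (u k).re 0 with h | h
  · rw [abs_of_nonpos h]
    linarith [Real.log_nonneg (le_add_of_nonneg_right hpos)]
  · rw [abs_of_nonneg h]
    have h1 : ‖Complex.exp (u k)‖ ^ 2 ≤ ∑ k, ‖Complex.exp (u k)‖ ^ 2 :=
      Finset.single_le_sum (f := fun k => ‖Complex.exp (u k)‖ ^ 2)
        (fun k _ => by positivity) (Finset.mem_univ k)
    have hexp : 0 < ‖Complex.exp (u k)‖ := norm_pos_iff.2 (Complex.exp_ne_zero _)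
    have h2 := Real.log_le_log (by positivity) (h1.trans (le_add_of_nonneg_left zero_le_one))
    rw [Real.log_pow, Complex.norm_exp, Real.log_exp] at h2
    push_cast at h2
    linarith

/-! ### Variance of logarithmic derivatives and quadratic exponents -/

section

variable {κ : Type*} [Fintype κ]

/-- The identity `E|x - m|² = E|x|² - |m|²` for the mean `m`, multiplied by the total weight. It
reads the energy density as a variance. -/
theorem sum_mul_norm_sub_mean_sq (w : κ → ℝ) (hw : ∑ k, w k ≠ 0) (x : κ → ℂ) :
    ∑ k, w k * ‖x k - (∑ k, w k)⁻¹ • ∑ k, w k • x k‖ ^ 2 =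
      ∑ k, w k * ‖x k‖ ^ 2 - ‖∑ k, w k • x k‖ ^ 2 / ∑ k, w k := by
  set T := ∑ k, w k with hT
  set s := ∑ k, w k • x k with hs
  have h1 : ∀ k, w k * ‖x k - T⁻¹ • s‖ ^ 2 =
      w k * ‖x k‖ ^ 2 - 2 * inner ℝ (w k • x k) (T⁻¹ • s) + w k * ‖T⁻¹ • s‖ ^ 2 := by
    intro k
    rw [norm_sub_sq_real, real_inner_smul_left]
    ring
  simp_rw [h1]
  rw [Finset.sum_add_distrib, Finset.sum_sub_distrib, ← Finset.mul_sum, ← sum_inner, ← hs,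
    ← Finset.sum_mul, ← hT, real_inner_smul_right, real_inner_self_eq_norm_sq, norm_smul, norm_inv,
    mul_pow, inv_pow, Real.norm_eq_abs, sq_abs]
  field_simp
  ring

/-- If `F i` has maximal modulus, then `x i` is controlled by the variance of `x` with respect to
the weights `‖F k‖ ^ 2`. -/
theorem norm_sub_mean_sq_le_of_forall_norm_le (F x : κ → ℂ) {i : κ} (hFi : F i ≠ 0)
    (hi : ∀ k, ‖F k‖ ≤ ‖F i‖) :
    ‖x i - (∑ k, ‖F k‖ ^ 2)⁻¹ • ∑ k, ‖F k‖ ^ 2 • x k‖ ^ 2 ≤ Fintype.card κ *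
      ((∑ k, ‖F k * x k‖ ^ 2) / (∑ k, ‖F k‖ ^ 2) -
        ‖∑ k, star (F k) * (F k * x k)‖ ^ 2 / (∑ k, ‖F k‖ ^ 2) ^ 2) := by
  have hwi : 0 < ‖F i‖ ^ 2 := by positivity
  -- By maximality, `i` carries at least the fraction `1 / card κ` of the total weight.
  have hle : ∑ k, ‖F k‖ ^ 2 ≤ Fintype.card κ * ‖F i‖ ^ 2 := by
    rw [← nsmul_eq_mul, ← Finset.card_univ]
    exact Finset.sum_le_card_nsmul _ _ _ fun k _ => by
      gcongr
      exact hi k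
  have hT : 0 < ∑ k, ‖F k‖ ^ 2 := lt_of_lt_of_le hwi
    (Finset.single_le_sum (f := fun k => ‖F k‖ ^ 2) (fun k _ => by positivity) (Finset.mem_univ i))
  have hvar := sum_mul_norm_sub_mean_sq (fun k => ‖F k‖ ^ 2) hT.ne' x
  have hsingle := Finset.single_le_sum
    (f := fun k => ‖F k‖ ^ 2 * ‖x k - (∑ k, ‖F k‖ ^ 2)⁻¹ • ∑ k, ‖F k‖ ^ 2 • x k‖ ^ 2)
    (fun k _ => by positivity) (Finset.mem_univ i)
  rw [hvar] at hsingle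
  have hs : ∑ k, star (F k) * (F k * x k) = ∑ k, ‖F k‖ ^ 2 • x k := by
    refine Finset.sum_congr rfl fun k _ => ?_
    rw [← mul_assoc, Complex.star_def, Complex.conj_mul', Complex.real_smul]
    push_cast
    rfl
  simp_rw [hs, norm_mul, mul_pow]
  generalize ‖∑ k, ‖F k‖ ^ 2 • x k‖ ^ 2 = Q at *
  have hY : 0 ≤ ‖x i - (∑ k, ‖F k‖ ^ 2)⁻¹ • ∑ k, ‖F k‖ ^ 2 • x k‖ ^ 2 := sq_nonneg _
  generalize ‖x i - (∑ k, ‖F k‖ ^ 2)⁻¹ • ∑ k, ‖F k‖ ^ 2 • x k‖ ^ 2 = Y at *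
  generalize ∑ k, ‖F k‖ ^ 2 * ‖x k‖ ^ 2 = A at *
  generalize ∑ k, ‖F k‖ ^ 2 = T at *
  have h1 : Y * T ≤ Fintype.card κ * (A - Q / T) :=
    calc Y * T ≤ Y * (Fintype.card κ * ‖F i‖ ^ 2) := by gcongr
      _ = Fintype.card κ * (‖F i‖ ^ 2 * Y) := by ring
      _ ≤ _ := by gcongr
  rw [← le_div_iff₀ hT] at h1
  refine h1.trans (le_of_eq ?_)
  field_simp

theorem norm_sub_le_of_forall_norm_le (F x : κ → ℂ) {C : ℝ}
    (hC : (∑ k, ‖F k * x k‖ ^ 2) / (∑ k, ‖F k‖ ^ 2) -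
        ‖∑ k, star (F k) * (F k * x k)‖ ^ 2 / (∑ k, ‖F k‖ ^ 2) ^ 2 ≤ C)
    {i j : κ} (hFi : F i ≠ 0) (hFj : F j ≠ 0) (hi : ∀ k, ‖F k‖ ≤ ‖F i‖)
    (hj : ∀ k, ‖F k‖ ≤ ‖F j‖) :
    ‖x i - x j‖ ≤ 2 * √(Fintype.card κ * C) := by
  have hm : ∀ l, F l ≠ 0 → (∀ k, ‖F k‖ ≤ ‖F l‖) →
      ‖x l - (∑ k, ‖F k‖ ^ 2)⁻¹ • ∑ k, ‖F k‖ ^ 2 • x k‖ ≤ √(Fintype.card κ * C) := by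
    intro l hl hmax
    refine Real.le_sqrt_of_sq_le ((norm_sub_mean_sq_le_of_forall_norm_le F x hl hmax).trans ?_)
    gcongr
  have h1 := hm i hFi hi
  have h2 := hm j hFj hj
  have h3 := norm_sub_le_norm_sub_add_norm_sub (x i)
    ((∑ k, ‖F k‖ ^ 2)⁻¹ • ∑ k, ‖F k‖ ^ 2 • x k) (x j)
  rw [norm_sub_rev (x j)] at h2
  linarith

theorem exists_forall_norm_sub_le (b : κ → ℂ) : ∃ B : ℝ, 0 ≤ B ∧ ∀ i j, ‖b i - b j‖ ≤ B := by
  obtain ⟨B, hB⟩ := (Set.finite_range fun p : κ × κ => ‖b p.1 - b p.2‖).bddAbove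
  exact ⟨max B 0, le_max_right _ _, fun i j => (hB ⟨(i, j), rfl⟩).trans (le_max_left _ _)⟩

theorem exists_pos_le_norm_sub (a : κ → ℂ) :
    ∃ δ : ℝ, 0 < δ ∧ ∀ i j, a i ≠ a j → δ ≤ ‖a i - a j‖ := by
  classical
  obtain ⟨B, hB⟩ := (Set.finite_range fun p : κ × κ => ‖a p.1 - a p.2‖⁻¹).bddAbove
  refine ⟨(max B 1)⁻¹, by positivity, fun i j hij => ?_⟩
  have hpos : 0 < ‖a i - a j‖ := norm_pos_iff.2 (sub_ne_zero.2 hij)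
  rw [inv_le_comm₀ (by positivity) hpos]
  exact (hB ⟨(i, j), rfl⟩).trans (le_max_left _ _)

theorem exists_norm_eq_and_mul_sq_eq (d : ℂ) {r : ℝ} (hr : 0 ≤ r) :
    ∃ z : ℂ, ‖z‖ = r ∧ d * z ^ 2 = ((‖d‖ * r ^ 2 : ℝ) : ℂ) := by
  -- Squaring doubles the angle `-arg d / 2`, which then cancels the argument of `d`.
  refine ⟨r * Complex.exp (((-d.arg / 2 : ℝ) : ℂ) * Complex.I), ?_, ?_⟩
  · rw [norm_mul, Complex.norm_exp_ofReal_mul_I, Complex.norm_of_nonneg hr, mul_one]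
  · have hd := Complex.norm_mul_exp_arg_mul_I d
    rw [mul_pow, ← Complex.exp_nat_mul]
    have h : Complex.exp (d.arg * Complex.I) *
        Complex.exp ((2 : ℕ) * (((-d.arg / 2 : ℝ) : ℂ) * Complex.I)) = 1 := by
      rw [← Complex.exp_add, ← Complex.exp_zero]
      congr 1
      push_cast
      ring
    generalize Complex.exp ((2 : ℕ) * (((-d.arg / 2 : ℝ) : ℂ) * Complex.I)) = E at *
    push_cast
    linear_combination (‖d‖ * r ^ 2 : ℂ) * h - (r : ℂ) ^ 2 * E * hd

/-- Quadratic polynomials whose derivatives stay close to each other wherever the corresponding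
real parts are simultaneously maximal have the same leading coefficient. -/
theorem leadingCoeff_eq_of_norm_deriv_sub_le [Nonempty κ] (a b c : κ → ℂ) {D : ℝ}
    (hD : ∀ z i j,
      (∀ k, (a k * z ^ 2 + b k * z + c k).re ≤ (a i * z ^ 2 + b i * z + c i).re) →
      (∀ k, (a k * z ^ 2 + b k * z + c k).re ≤ (a j * z ^ 2 + b j * z + c j).re) →
      ‖(2 * a i * z + b i) - (2 * a j * z + b j)‖ ≤ D) (i j : κ) : a i = a j := by
  by_contra hij
  obtain ⟨δ, hδ, hsep⟩ := exists_pos_le_norm_sub a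
  obtain ⟨B, hB0, hB⟩ := exists_forall_norm_sub_le b
  obtain ⟨B', hB'0, hB'⟩ := exists_forall_norm_sub_le c
  set u : κ → ℂ → ℝ := fun k z => (a k * z ^ 2 + b k * z + c k).re with hu
  have huc : ∀ k, Continuous (u k) := fun k => Complex.continuous_re.comp (by fun_prop)
  -- Beyond this radius the gap `δ` between distinct leading coefficients outweighs the lower
  -- coefficients and `D`.
  obtain ⟨r, hr⟩ := exists_gt (max 1 ((B + B' + |D|) / δ))
  have hr1 : 1 ≤ r := (le_max_left _ _).trans hr.le
  have hrδ : B + B' + |D| < δ * r := by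
    have := (le_max_right _ _).trans_lt hr
    rwa [div_lt_iff₀' hδ] at this
  have hmax : ∀ z, ∃ l, ∀ k, u k z ≤ u l z := fun z => Finite.exists_max fun k => u k z
  have hclosed : ∀ p : κ → Prop, IsClosed {z | ∃ l, p l ∧ ∀ k, u k z ≤ u l z} := by
    intro p
    have : {z | ∃ l, p l ∧ ∀ k, u k z ≤ u l z} = ⋃ l ∈ {l | p l}, ⋂ k, {z | u k z ≤ u l z} := by
      ext z
      simp
    rw [this]
    exact (Set.toFinite _).isClosed_biUnion fun l _ =>
      isClosed_iInter fun k => isClosed_le (huc k) (huc l)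
  obtain ⟨l₀, hl₀⟩ := hmax (r : ℂ)
  have hmem : (r : ℂ) ∈ Metric.sphere (0 : ℂ) r := by
    simp [abs_of_nonneg (zero_le_one.trans hr1)]
  -- Where `(a m - a l₀) z²` is real and positive, `m` beats every index with leading coefficient `a
  -- l₀`, so the maximum is attained elsewhere.
  have hother : ∃ z ∈ Metric.sphere (0 : ℂ) r, ∃ l, a l ≠ a l₀ ∧ ∀ k, u k z ≤ u l z := by
    obtain ⟨m, hm⟩ : ∃ m, a m ≠ a l₀ := by
      by_contra! h
      exact hij ((h i).trans (h j).symm)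
    obtain ⟨z, hz, hzm⟩ := exists_norm_eq_and_mul_sq_eq (a m - a l₀) (zero_le_one.trans hr1)
    obtain ⟨l, hl⟩ := hmax z
    refine ⟨z, mem_sphere_zero_iff_norm.2 hz, l, fun hal => ?_, hl⟩
    have h1 : u m z - u l z =
        ‖a m - a l₀‖ * r ^ 2 + ((b m - b l) * z).re + (c m - c l).re := by
      rw [← Complex.ofReal_re (‖a m - a l₀‖ * r ^ 2), ← hzm, hu, ← hal]
      simp only [← Complex.add_re, ← Complex.sub_re]
      congr 1
      ring
    have h2 := neg_le_of_abs_le ((Complex.abs_re_le_norm _).trans (hB' m l))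
    have h3 : |((b m - b l) * z).re| ≤ B * r := by
      refine (Complex.abs_re_le_norm _).trans ?_
      rw [norm_mul, hz]
      gcongr
      exact hB m l
    have h4 := neg_le_of_abs_le h3
    have h5 : δ * r * r ≤ ‖a m - a l₀‖ * r ^ 2 := by
      rw [mul_assoc, ← pow_two]
      gcongr
      exact hsep m l₀ hm
    have h6 : (B + B' + |D|) * r < δ * r * r := by gcongr
    have h7 : B' * 1 ≤ B' * r := by gcongr
    have h8 : 0 ≤ |D| * r := by positivity
    linarith [hl m]
  obtain ⟨z₁, hz₁, l₁, hl₁, hmax₁⟩ := hother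
  -- Two nonempty closed sets covering the connected circle must meet, which yields a tie between
  -- maximal indices with different leading coefficients.
  obtain ⟨z, hz, ⟨l, hal, hl⟩, m, ham, hm⟩ := isPreconnected_closed_iff.1
    (isPreconnected_sphere (by rw [Complex.rank_real_complex]; exact Cardinal.one_lt_two) (0 : ℂ) r) _ _
    (hclosed fun l => a l = a l₀) (hclosed fun l => a l ≠ a l₀)
    (fun z _ => by
      obtain ⟨l, hl⟩ := hmax z
      by_cases h : a l = a l₀
      · exact Or.inl ⟨l, h, hl⟩
      · exact Or.inr ⟨l, h, hl⟩)
    ⟨r, hmem, l₀, rfl, hl₀⟩ ⟨z₁, hz₁, l₁, hl₁, hmax₁⟩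
  have hne : a l ≠ a m := fun h => ham (h.symm.trans hal)
  have h1 := hD z l m hl hm
  -- At the tie the derivatives differ by at least `2 δ r - B`, which exceeds `D`.
  have h2 : 2 * (a l - a m) * z = ((2 * a l * z + b l) - (2 * a m * z + b m)) - (b l - b m) := by
    ring
  have h3 := norm_sub_le ((2 * a l * z + b l) - (2 * a m * z + b m)) (b l - b m)
  rw [← h2, norm_mul, norm_mul, mem_sphere_zero_iff_norm.1 hz] at h3
  have h4 : δ * r ≤ ‖a l - a m‖ * r := by
    gcongr
    exact hsep l m hne
  have h5 : 0 < δ * r := by positivity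
  norm_num at h3
  linarith [hB l m, le_abs_self D]

end

/-! ### Exponential form and conclusion -/

/-- Let `g` be a primitive of `F' / F` with `exp (g 0) = F 0`; then `F exp(-g)` has zero derivative.
-/
theorem exists_eq_exp_of_forall_ne_zero {F : ℂ → ℂ} (hF : Differentiable ℂ F) (h0 : ∀ z, F z ≠ 0) :
    ∃ g : ℂ → ℂ, Differentiable ℂ g ∧ ∀ z, F z = Complex.exp (g z) := by
  have hd : Differentiable ℂ fun z => deriv F z / F z := hF.deriv.fun_div hF h0
  obtain ⟨g, hg0, hg⟩ := hd.isExactOn_univ.with_val_at 0 (Complex.log (F 0))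
  have hg' : ∀ z, HasDerivAt g (deriv F z / F z) z := fun z => hg z (Set.mem_univ z)
  refine ⟨g, fun z => (hg' z).differentiableAt, fun z => ?_⟩
  have hconst : ∀ z, HasDerivAt (fun z => F z * Complex.exp (-g z)) 0 z := by
    intro z
    refine ((hF z).hasDerivAt.mul (hg' z).neg.cexp).congr_deriv ?_
    field_simp [h0 z]
    ring
  have h1 := is_const_of_deriv_eq_zero (fun z => (hconst z).differentiableAt)
    (fun z => (hconst z).deriv) z 0
  simp only [hg0, Complex.exp_neg, Complex.exp_log (h0 0), mul_inv_cancel₀ (h0 0)] at h1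
  exact (mul_inv_eq_one₀ (Complex.exp_ne_zero _)).1 h1

open Real in
/-- Entire functions `g k` for which the curve `[1 : exp (g 1) : ⋯ : exp (g n)]` has bounded energy
density are affine. -/
theorem exists_eq_affine_of_energyDensity_le {ι : Type*} [Fintype ι] {g : ι → ℂ → ℂ}
    (hg : ∀ k, Differentiable ℂ (g k)) {C : ℝ}
    (hC : ∀ z, (∑ k, ‖deriv (fun w => Complex.exp (g k w)) z‖ ^ 2) /
        (1 + ∑ k, ‖Complex.exp (g k z)‖ ^ 2) -
      ‖∑ k, star (Complex.exp (g k z)) * deriv (fun w => Complex.exp (g k w)) z‖ ^ 2 /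
        (1 + ∑ k, ‖Complex.exp (g k z)‖ ^ 2) ^ 2 ≤ C) (k : ι) :
    ∃ a b : ℂ, ∀ z, g k z = a * z + b := by
  have hF : ∀ k, Differentiable ℂ fun w => Complex.exp (g k w) := fun k => (hg k).cexp
  have hφ := (contDiff_log_one_add_sum_norm_sq hF).continuous
  have hquad : ∀ k, ∃ a b c : ℂ, ∀ z, g k z = a * z ^ 2 + b * z + c := by
    intro k
    set L := Real.log (1 + ∑ k, ‖Complex.exp (g k 0)‖ ^ 2)
    -- The first summand of `K` absorbs the constant `L - Re g_k(0)`, since `R ≥ 1`.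
    refine (hg k).exists_eq_quadratic (K := |L - (g k 0).re| + (C + 1)) fun R hR => ?_
    have hre : Continuous fun z => (g k z).re := Complex.continuous_re.comp (hg k).continuous
    have h1 := circleAverage_mono (c := 0) (R := R)
      hre.abs.continuousOn.circleIntegrable' (hφ.sub hre).continuousOn.circleIntegrable'
      fun z _ => abs_le_log_one_add_sum_sub (fun k => g k z) k
    -- `C + 1` turns the bound on the density into a strict one.
    have h2 := circleAverage_log_one_add_sum_le hF (C := C + 1)
      (fun z => (hC z).trans_lt (lt_add_one C)) (zero_le_one.trans hR)
    have h3 := circleAverage_fun_sub (c := 0) (R := R)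
      hφ.continuousOn.circleIntegrable' hre.continuousOn.circleIntegrable'
    rw [(hg k).circleAverage_re_eq] at h3
    have h4 : |L - (g k 0).re| * 1 ≤ |L - (g k 0).re| * R ^ 2 := by
      gcongr
      exact one_le_pow₀ hR
    have h5 := le_abs_self (L - (g k 0).re)
    rw [add_mul]
    linarith [h1.trans_eq h3]
  choose a b c habc using hquad
  have hderiv : ∀ k z, deriv (fun w => Complex.exp (g k w)) z =
      Complex.exp (g k z) * (2 * a k * z + b k) := by
    intro k z
    have h : HasDerivAt (g k) (2 * a k * z + b k) z := by
      rw [funext (habc k)]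
      refine ((((hasDerivAt_id z).pow 2).const_mul (a k)).add
        ((hasDerivAt_id z).const_mul (b k))).add_const (c k) |>.congr_deriv ?_
      simp
      ring
    exact h.cexp.deriv
  -- The index `none` stands for the homogeneous coordinate `1 = exp 0`: it supplies the `1 +` in
  -- the sums, and comparison with it gives `a k = 0`.
  have hlead := leadingCoeff_eq_of_norm_deriv_sub_le (κ := Option ι)
    (fun o => o.elim 0 a) (fun o => o.elim 0 b) (fun o => o.elim 0 c)
    (D := 2 * √(Fintype.card (Option ι) * C)) (fun z i j hi hj => by
      have hmax : ∀ l : Option ι, (∀ k : Option ι,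
          (k.elim 0 a * z ^ 2 + k.elim 0 b * z + k.elim 0 c).re ≤
            (l.elim 0 a * z ^ 2 + l.elim 0 b * z + l.elim 0 c).re) → ∀ k : Option ι,
          ‖Complex.exp (k.elim 0 a * z ^ 2 + k.elim 0 b * z + k.elim 0 c)‖ ≤
            ‖Complex.exp (l.elim 0 a * z ^ 2 + l.elim 0 b * z + l.elim 0 c)‖ := by
        intro l hl k
        rw [Complex.norm_exp, Complex.norm_exp]
        exact Real.exp_le_exp.2 (hl k)
      refine norm_sub_le_of_forall_norm_le
        (fun o : Option ι => Complex.exp (o.elim 0 a * z ^ 2 + o.elim 0 b * z + o.elim 0 c))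
        (fun o => 2 * o.elim 0 a * z + o.elim 0 b) ?_ (Complex.exp_ne_zero _)
        (Complex.exp_ne_zero _) (hmax i hi) (hmax j hj)
      have hz := hC z
      simp_rw [hderiv, habc] at hz
      simpa [Fintype.sum_option] using hz) (some k) none
  refine ⟨b k, c k, fun z => ?_⟩
  rw [habc, show a k = 0 from hlead]
  ring

theorem mainTheorem7 (n : ℕ) (f : ℂ → ComplexProjectiveSpace n)
    (hf : MDifferentiable 𝓘(ℂ) 𝓘(ℂ, Fin n → ℂ) f)
    (hP : ∀ z, f z ∉ ⋃ i, ComplexProjectiveSpace.hyperplane i)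
    (hdf : ComplexProjectiveSpace.differentialSupNorm f < ⊤) :
    ∃ a b : Fin n → ℂ, ∀ z : ℂ,
      f z = ComplexProjectiveSpace.affinePoint 0 fun i => Complex.exp (a i * z + b i) := by
  have hd := differentiable_pi.1 (ComplexProjectiveSpace.differentiable_affineCoord hf hP)
  have hne : ∀ k z, ComplexProjectiveSpace.affineCoord 0 (f z) k ≠ 0 := fun k z =>
    div_ne_zero (ComplexProjectiveSpace.rep_ne_zero_of_notMem (hP z) _)
      (ComplexProjectiveSpace.rep_ne_zero_of_notMem (hP z) _)
  choose g hg hgF using fun k => exists_eq_exp_of_forall_ne_zero (hd k) (hne k)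
  obtain ⟨C, hC⟩ := ComplexProjectiveSpace.exists_energyDensity_le hf hP hdf
  simp_rw [hgF] at hC
  choose a b hab using exists_eq_affine_of_energyDensity_le hg hC
  refine ⟨a, b, fun z => ?_⟩
  rw [← (ComplexProjectiveSpace.affineChart 0).left_inv
    (ComplexProjectiveSpace.rep_ne_zero_of_notMem (hP z) 0)]
  refine congrArg (ComplexProjectiveSpace.affinePoint 0) (funext fun k => ?_)
  rw [← hab, ← hgF]
  rfl
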